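/- **Theorem (Iteration complexity of Smoothed GDA).** Consider $\min_{x\in\mathcal X}\max_{y\in\mathcal Y} f(x,y)$, where $\mathcal X\subseteq\mathbb R^n$ is closed and convex, $\mathcal Y\subseteq\mathbb R^d$ is compact and convex with diameter $D_{\mathcal Y}>0$, $f:\mathbb R^n\times\mathbb R^d\to\mathbb R$ is continuously differentiable, $f(x,\cdot)$ is concave on $\mathcal Y$ for every $x\in\mathcal X$, and for some $\ell>0$, for all $x,x'\in\mathcal X$ and $y,y'\in\mathcal Y$, both $\|\nabla_xf(x,y)-\nabla_xf(x',y')\|$ and $\|\nabla_yf(x,y)-\nabla_yf(x',y')\|$ are at most $\ell(\|x-x'\|+\|y-y'\|)$. Let $\Phi(x)=\max_{y\in\mathcal Y}f(x,y)$ be bounded below on $\mathcal X$. Write $F(x,y,z)=f(x,y)+\frac{r_x}{2}\|x-z\|^2$. *Smoothed GDA*, started at $(x_0,y_0,z_0)\in\mathcal X\times\mathcal Y\times\mathbb R^n$, is the iteration $$x_{t+1}=\mathrm{proj}_{\mathcal X}(x_t-c\nabla_xF(x_t,y_t,z_t)),\quad y_{t+1}=\mathrm{proj}_{\mathcal Y}(y_t+\alpha\nabla_yF(x_{t+1},y_t,z_t)),\quad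 z_{t+1}=z_t+\beta(x_{t+1}-z_t).$$ Put $\Psi_2(x,y,z)=F(x,y,z)-2\inf_{x'\in\mathcal X}F(x',y,z)+2\inf_{x'\in\mathcal X}\max_{y'\in\mathcal Y}F(x',y',z)$ and $\Delta_{\Psi_2}=\Psi_2(x_0,y_0,z_0)-\inf_{x\in\mathcal X}\Phi(x)$. Let $\epsilon>0$. A point $x\in\mathcal X$ is an *$\epsilon$-OS* if $\Phi+\ell\|\cdot-x\|^2$ has a unique minimizer $p$ over $\mathcal X$ (so $p=\mathrm{prox}_{\Phi/(2\ell)}(x)$) and $\|p-x\|\le\frac{\epsilon}{2\ell}$. A pair $(x,y)\in\mathcal X\times\mathcal Y$ is an *$\epsilon$-GS* if $\mathrm{dist}(0,\nabla_xf(x,y)+\partial\iota_{\mathcal X}(x))\le\epsilon$ and $\mathrm{dist}(0,-\nabla_yf(x,y)+\partial\iota_{\mathcal Y}(y))\le\epsilon$, where $\iota$ denotes the indicator function of a convex set. For all constants $\kappa,\gamma,a>0$ there is a constant $b_0>0$ such that for every $b_1>0$ there is a constant $C>0$ (so $b_0$ depends only on $\kappa,\gamma,a$ and $C$ only on $\kappa,\gamma,a,b_1$)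 with the following property, for all dimensions, problems and starting points as above and all $\epsilon>0$. Suppose the parameters satisfy * $3\ell<r_x\le\kappa\ell$ (that is, $r_x=\Theta(\ell)$); * $\frac{\gamma}{\ell}\le c<\frac1{r_x+\ell}$ (that is, $c=\Theta(1/\ell)$); * $\frac a\ell\le\alpha\le\min\bigl\{\frac1{11\ell},\frac{c^2(r_x-\ell)^2}{4\ell(1+c(r_x-\ell))^2}\bigr\}$ (that is, $\alpha=\Theta(1/\ell)$); * $0<\beta\le\min\bigl\{\frac1{36},\frac{(r_x-\ell)^2}{384\,r_x(r_x+\ell)^2}\bigr\}$ and $b_1\frac{\epsilon^2}{\ell^2D_{\mathcal Y}^2}\le\beta\le b_0\frac{\epsilon^2}{\ell^2D_{\mathcal Y}^2}$ (that is, $\beta=\Theta(\epsilon^2/(\ell^2D_{\mathcal Y}^2))$ with a sufficiently small constant). Then there is an index $t\ge0$ with $$t\le C\,\frac{\ell^3D_{\mathcal Y}^2\Delta_{\Psi_2}}{\epsilon^4}$$ such that $(x_{t+1},y_{t+1})$ is an $\epsilon$-GS and $x_{t+1}$ is an $\epsilon$-OS of the problem. -/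

import Mathlib

namespace MinimaxNCC

/-- Euclidean space of dimension `n`. -/
abbrev E (n : ℕ) : Type := EuclideanSpace ℝ (Fin n)

/-- `f` is continuously differentiable and its partial gradients are `ℓ`-Lipschitz on `X × Y`. -/
structure IsSmoothOn {n d : ℕ} (f : E n → E d → ℝ) (X : Set (E n)) (Y : Set (E d)) (ℓ : ℝ) :
    Prop where
  pos : 0 < ℓ
  contDiff : ContDiff ℝ 1 (fun q : E n × E d => f q.1 q.2)
  lipschitz_x : ∀ x ∈ X, ∀ x' ∈ X, ∀ y ∈ Y, ∀ y' ∈ Y,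
    ‖gradient (fun u => f u y) x - gradient (fun u => f u y') x'‖ ≤ ℓ * (‖x - x'‖ + ‖y - y'‖)
  lipschitz_y : ∀ x ∈ X, ∀ x' ∈ X, ∀ y ∈ Y, ∀ y' ∈ Y,
    ‖gradient (fun v => f x v) y - gradient (fun v => f x' v) y'‖ ≤ ℓ * (‖x - x'‖ + ‖y - y'‖)

/-- The value function `Φ(x) = max_{y ∈ Y} f(x, y)` (finite part; the constraint `x ∈ X` is imposed
separately wherever `Φ` is minimized). -/
noncomputable def valueFn {n d : ℕ} (f : E n → E d → ℝ) (Y : Set (E d)) (x : E n) : ℝ :=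
  sSup ((fun y => f x y) '' Y)

/-- The set of minimizers over `X` of `u ↦ φ(u) + (1/(2s)) ‖u - x‖²`;
`prox_{s φ}(x)` is its unique element. -/
def proxSet {n : ℕ} (X : Set (E n)) (φ : E n → ℝ) (s : ℝ) (x : E n) : Set (E n) :=
  {u | u ∈ X ∧ ∀ w ∈ X,
    φ u + 1 / (2 * s) * ‖u - x‖ ^ 2 ≤ φ w + 1 / (2 * s) * ‖w - x‖ ^ 2}

/-- `x` is an `ε`-optimization-stationary point: `x ∈ X`, the proximal point
`prox_{Φ/(2ℓ)}(x)` is well defined, and its distance to `x` is at most `ε/(2ℓ)`. -/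
def IsOS {n d : ℕ} (f : E n → E d → ℝ) (X : Set (E n)) (Y : Set (E d)) (ℓ ε : ℝ)
    (x : E n) : Prop :=
  x ∈ X ∧ ∃ p : E n, proxSet X (valueFn f Y) (1 / (2 * ℓ)) x = {p} ∧ ‖p - x‖ ≤ ε / (2 * ℓ)

/-- The normal cone of `S` at `x`, i.e. the subdifferential at `x ∈ S` of the indicator
function of the convex set `S`. -/
def normalCone {n : ℕ} (S : Set (E n)) (x : E n) : Set (E n) :=
  {v | ∀ u ∈ S, inner ℝ v (u - x) ≤ 0}

/-- `(x, y)` is an `ε`-game-stationary point: `(x, y) ∈ X × Y`,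
`dist(0, ∇ₓ f(x,y) + ∂ι_X(x)) ≤ ε` and `dist(0, -∇_y f(x,y) + ∂ι_Y(y)) ≤ ε`. -/
def IsGS {n d : ℕ} (f : E n → E d → ℝ) (X : Set (E n)) (Y : Set (E d)) (ε : ℝ)
    (x : E n) (y : E d) : Prop :=
  x ∈ X ∧ y ∈ Y ∧
    Metric.infDist 0 ((fun v => gradient (fun u => f u y) x + v) '' normalCone X x) ≤ ε ∧
    Metric.infDist 0 ((fun v => -gradient (fun w => f x w) y + v) '' normalCone Y y) ≤ ε

/-- `v` is a Euclidean projection of `u` onto `S` (the projection, for `S` closed and convex). -/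
def IsProj {n : ℕ} (S : Set (E n)) (u v : E n) : Prop :=
  v ∈ S ∧ ∀ w ∈ S, ‖u - v‖ ≤ ‖u - w‖

/-- The smoothed surrogate `F(x, y, z) = f(x, y) + (r/2) ‖x - z‖²`. -/
noncomputable def surrogate {n d : ℕ} (f : E n → E d → ℝ) (r : ℝ) (x : E n) (y : E d)
    (z : E n) : ℝ :=
  f x y + r / 2 * ‖x - z‖ ^ 2

/-- The sequence `(x t, y t, z t)` is generated by Smoothed GDA with parameters `r, c, α, β`
from an initial point in `X × Y × ℝⁿ`. -/
structure IsSmoothedGDA {n d : ℕ} (f : E n → E d → ℝ) (X : Set (E n)) (Y : Set (E d))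
    (r c α β : ℝ) (x : ℕ → E n) (y : ℕ → E d) (z : ℕ → E n) : Prop where
  init_x : x 0 ∈ X
  init_y : y 0 ∈ Y
  step_x : ∀ t, IsProj X
    (x t - c • gradient (fun u => surrogate f r u (y t) (z t)) (x t)) (x (t + 1))
  step_y : ∀ t, IsProj Y
    (y t + α • gradient (fun v => surrogate f r (x (t + 1)) v (z t)) (y t)) (y (t + 1))
  step_z : ∀ t, z (t + 1) = z t + β • (x (t + 1) - z t)

/-- `d(y, z) = min_{x ∈ X} F(x, y, z)`. -/
noncomputable def dualFn {n d : ℕ} (f : E n → E d → ℝ) (X : Set (E n)) (r : ℝ) (y : E d)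
    (z : E n) : ℝ :=
  sInf ((fun x => surrogate f r x y z) '' X)

/-- `p(z) = min_{x ∈ X} max_{y ∈ Y} F(x, y, z)`. -/
noncomputable def proxFn {n d : ℕ} (f : E n → E d → ℝ) (X : Set (E n)) (Y : Set (E d)) (r : ℝ)
    (z : E n) : ℝ :=
  sInf ((fun x => sSup ((fun y => surrogate f r x y z) '' Y)) '' X)

/-- The potential `Ψ₂(x, y, z) = F(x, y, z) - 2 d(y, z) + 2 p(z)`. -/
noncomputable def potential {n d : ℕ} (f : E n → E d → ℝ) (X : Set (E n)) (Y : Set (E d))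
    (r : ℝ) (x : E n) (y : E d) (z : E n) : ℝ :=
  surrogate f r x y z - 2 * dualFn f X r y z + 2 * proxFn f X Y r z

/-- The initial gap `Δ = Ψ₂(x₀, y₀, z₀) - min_{x ∈ X} max_{y ∈ Y} f(x, y)`. -/
noncomputable def initialGap {n d : ℕ} (f : E n → E d → ℝ) (X : Set (E n)) (Y : Set (E d))
    (r : ℝ) (x₀ : E n) (y₀ : E d) (z₀ : E n) : ℝ :=
  potential f X Y r x₀ y₀ z₀ - sInf (valueFn f Y '' X)

/-- The step-size conditions common to all accuracies. The numbers `κ, γ, a` are the constants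
hidden in `r = Θ(ℓ)`, `c = Θ(1/ℓ)`, `α = Θ(1/ℓ)`; the opposite bounds of these three relations
follow from the explicit inequalities. -/
structure StepSizes (κ γ a ℓ r c α β : ℝ) : Prop where
  r_lower : 3 * ℓ < r
  r_upper : r ≤ κ * ℓ
  c_lower : γ / ℓ ≤ c
  c_upper : c < 1 / (r + ℓ)
  α_lower : a / ℓ ≤ α
  α_upper : α ≤ min (1 / (11 * ℓ)) (c ^ 2 * (r - ℓ) ^ 2 / (4 * ℓ * (1 + c * (r - ℓ)) ^ 2))
  β_pos : 0 < β
  β_upper : β ≤ min (1 / 36) ((r - ℓ) ^ 2 / (384 * r * (r + ℓ) ^ 2))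

end MinimaxNCC

/-! Since r > 3ℓ, the proximal term makes F(·, y, z) strongly convex with modulus r - ℓ > 2ℓ, so its
minimizer over X depends Lipschitz-continuously on (y, z). The potential Ψ = F - 2d + 2p combines
three mechanisms. The x-step lowers F (`primal_descent`). The y-step raises F by at most ⟨∇_y f, y'
- y⟩ but raises 2d by about twice that (`dual_ascent_y`), a net change of about -‖y' - y‖²/α. The
z-step lowers F by about rβ‖u - z‖², at the price of a cross term 2rβ⟨u - z, p₂ - q⟩, where p₂
minimizes F(·, y', z') and q attains p(z).

As f is merely concave in y, the distance from the inner minimizer to q is controlled only through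
its square, by D times the first power of the steps (`sq_norm_argmin_sub_le`,
`valueFn_le_of_step_y`). Young's inequality then leaves an unavoidable residue of order ℓβ²D² per
iteration (`potential_step`).

For β a small multiple of ε²/(ℓ²D²) this residue is at most θβε²/ℓ. Either Ψ drops by θβε²/ℓ, or all
three steps are so small that the new iterate has both kinds of stationarity (`stationarity_arith`,
`isGS_and_isOS_of_step`). Since Ψ ≥ inf Φ, the first case occurs at most Δℓ/(θβε²) times, and the
lower bound on β turns this into order ℓ³D²Δ/ε⁴. -/

open Set Filter Topology
open scoped RealInnerProductSpace

namespace MinimaxNCC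

/-! ### Convexity and smoothness inequalities, by restriction to segments. -/

section Convex

variable {V : Type*} [NormedAddCommGroup V] [InnerProductSpace ℝ V]

/-- Quadratic growth, the variational inequality and the tangent bound for concave functions all
reduce to this one-sided test on a segment. -/
theorem nonneg_of_hasDerivAt_of_le {k : ℝ → ℝ} {k' : ℝ} (h : HasDerivAt k k' 0)
    (hk : ∀ t ∈ Ioc (0 : ℝ) 1, k 0 ≤ k t) : 0 ≤ k' := by
  refine ge_of_tendsto h.tendsto_slope_zero_right ?_
  filter_upwards [Ioc_mem_nhdsGT (zero_lt_one (α := ℝ))] with t ht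
  have := hk t ht
  simp only [zero_add, smul_eq_mul]
  exact mul_nonneg (inv_nonneg.2 ht.1.le) (by linarith)

theorem add_smul_sub_mem {s : Set V} (hs : Convex ℝ s) {x y : V} (hx : x ∈ s) (hy : y ∈ s)
    {t : ℝ} (ht : t ∈ Icc (0 : ℝ) 1) : x + t • (y - x) ∈ s :=
  hs.add_smul_sub_mem hx hy ht

theorem add_smul_sub_eq (x y : V) (t : ℝ) : x + t • (y - x) = (1 - t) • x + t • y := by
  module

/-- Quadratic growth of a strongly convex function around its minimizer. -/
theorem StrongConvexOn.growth {s : Set V} {g : V → ℝ} {μ : ℝ} (hg : StrongConvexOn s μ g)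
    {p v : V} (hp : p ∈ s) (hmin : ∀ w ∈ s, g p ≤ g w) (hv : v ∈ s) :
    g p + μ / 2 * ‖v - p‖ ^ 2 ≤ g v := by
  -- Strong convexity at p + t(v - p) and minimality of p make this function nonnegative on (0, 1];
  -- its derivative at 0 is the claim.
  have hd : HasDerivAt (fun t : ℝ => t * (g v - g p) - t * (1 - t) * (μ / 2 * ‖v - p‖ ^ 2))
      (g v - g p - μ / 2 * ‖v - p‖ ^ 2) 0 := by
    have h1 := hasDerivAt_id (0 : ℝ)
    have := (h1.mul_const (g v - g p)).sub
      ((h1.mul (h1.const_sub 1)).mul_const (μ / 2 * ‖v - p‖ ^ 2))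
    refine this.congr_deriv ?_
    simp
  have := nonneg_of_hasDerivAt_of_le hd fun t ht => by
    have h1 := hg.2 hp hv (sub_nonneg.2 ht.2) ht.1.le (by ring)
    have h2 := hmin _ (hg.1 hp hv (sub_nonneg.2 ht.2) ht.1.le (by ring))
    simp only [smul_eq_mul] at h1
    rw [norm_sub_rev p v] at h1
    nlinarith
  linarith

theorem StrongConvexOn.add_sq_norm_sub {s : Set V} {g : V → ℝ} {μ : ℝ}
    (hg : StrongConvexOn s μ g) (m : ℝ) (z : V) :
    StrongConvexOn s (μ + m) fun v => g v + m / 2 * ‖v - z‖ ^ 2 := by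
  refine ⟨hg.1, fun x hx y hy a b ha hb hab => ?_⟩
  have h := hg.2 hx hy ha hb hab
  obtain rfl : a = 1 - b := by linarith
  have e : ‖(1 - b) • x + b • y - z‖ ^ 2
      = (1 - b) * ‖x - z‖ ^ 2 + b * ‖y - z‖ ^ 2 - (1 - b) * b * ‖x - y‖ ^ 2 := by
    have e1 : (1 - b) • x + b • y - z = (1 - b) • (x - z) + b • (y - z) := by module
    have e2 : x - y = (x - z) - (y - z) := by abel
    rw [e1, e2, norm_add_sq_real, norm_sub_sq_real (x - z) (y - z), norm_smul,
      norm_smul, inner_smul_left, inner_smul_right, Real.norm_of_nonneg ha, Real.norm_of_nonneg hb]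
    simp only [conj_trivial]
    ring
  simp only [smul_eq_mul] at h ⊢
  rw [e]
  linarith

variable [CompleteSpace V]

theorem HasGradientAt.hasDerivAt_line {g : V → ℝ} {g' x h : V} {t : ℝ}
    (hg : HasGradientAt g g' (x + t • h)) :
    HasDerivAt (fun s : ℝ => g (x + s • h)) ⟪g', h⟫ t := by
  have h1 : HasDerivAt (fun s : ℝ => x + s • h) h t := by
    simpa using ((hasDerivAt_id t).smul_const h).const_add x
  have := hg.hasFDerivAt.comp_hasDerivAt t h1
  rwa [InnerProductSpace.toDual_apply_apply] at this

theorem inner_gradient_sub_nonneg {s : Set V} (hs : Convex ℝ s) {g : V → ℝ} {g' p v : V}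
    (hp : p ∈ s) (hmin : ∀ w ∈ s, g p ≤ g w) (hg : HasGradientAt g g' p) (hv : v ∈ s) :
    0 ≤ ⟪g', v - p⟫ := by
  have hd : HasDerivAt (fun t : ℝ => g (p + t • (v - p))) ⟪g', v - p⟫ 0 :=
    HasGradientAt.hasDerivAt_line (by simpa using hg)
  refine nonneg_of_hasDerivAt_of_le hd fun t ht => ?_
  simpa using hmin _ (add_smul_sub_mem hs hp hv ⟨ht.1.le, ht.2⟩)

theorem ConcaveOn.le_add_inner_gradient {s : Set V} {g : V → ℝ} (hc : ConcaveOn ℝ s g)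
    {g' y v : V} (hy : y ∈ s) (hv : v ∈ s) (hg : HasGradientAt g g' y) :
    g v ≤ g y + ⟪g', v - y⟫ := by
  have hd : HasDerivAt (fun t : ℝ => g (y + t • (v - y))) ⟪g', v - y⟫ 0 :=
    HasGradientAt.hasDerivAt_line (by simpa using hg)
  have := nonneg_of_hasDerivAt_of_le (hd.sub ((hasDerivAt_id (0 : ℝ)).mul_const (g v - g y)))
    fun t ht => by
      have h1 := hc.2 hy hv (sub_nonneg.2 ht.2) ht.1.le (by ring)
      simp only [smul_eq_mul] at h1
      rw [← add_smul_sub_eq] at h1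
      simp only [Pi.sub_apply, zero_smul, add_zero, id, zero_mul]
      linarith
  linarith

/-- The descent lemma on a convex set. -/
theorem le_add_of_lipschitz_gradient {s : Set V} (hs : Convex ℝ s) {g : V → ℝ} {g' : V → V}
    {L : ℝ} (hg : ∀ x ∈ s, HasGradientAt g (g' x) x)
    (hL : ∀ x ∈ s, ∀ y ∈ s, ‖g' x - g' y‖ ≤ L * ‖x - y‖) {x y : V} (hx : x ∈ s) (hy : y ∈ s) :
    g y ≤ g x + ⟪g' x, y - x⟫ + L / 2 * ‖y - x‖ ^ 2 := by
  set h := y - x with hh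
  have hd : ∀ t ∈ Icc (0 : ℝ) 1, HasDerivAt
      (fun t : ℝ => g (x + t • h) - (t * ⟪g' x, h⟫ + t * t * (L / 2 * ‖h‖ ^ 2)))
      (⟪g' (x + t • h), h⟫ - (⟪g' x, h⟫ + 2 * t * (L / 2 * ‖h‖ ^ 2))) t := fun t ht => by
    have h1 := hasDerivAt_id t
    refine (HasGradientAt.hasDerivAt_line (hg _ (add_smul_sub_mem hs hx hy ht))).sub
      (((h1.mul_const _).add ((h1.mul h1).mul_const _)).congr_deriv ?_)
    simp only [id]
    ring
  have hanti := antitoneOn_of_deriv_nonpos (convex_Icc (0 : ℝ) 1)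
    (fun t ht => (hd t ht).continuousAt.continuousWithinAt)
    (fun t ht => (hd t (interior_subset ht)).differentiableAt.differentiableWithinAt)
    (fun t ht => by
      have ht' := interior_subset ht
      rw [(hd t ht').deriv, ← sub_sub, ← inner_sub_left]
      have h1 := real_inner_le_norm (g' (x + t • h) - g' x) h
      have h2 := hL _ (add_smul_sub_mem hs hx hy ht') _ hx
      rw [add_sub_cancel_left, norm_smul, Real.norm_of_nonneg ht'.1] at h2
      have h3 := mul_le_mul_of_nonneg_right h2 (norm_nonneg h)
      nlinarith)
  have := hanti (left_mem_Icc.2 zero_le_one) (right_mem_Icc.2 zero_le_one) zero_le_one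
  simp only [one_smul, zero_smul, hh, add_sub_cancel, add_zero] at this
  rw [← hh] at this
  linarith

theorem sub_le_of_lipschitz_gradient {s : Set V} (hs : Convex ℝ s) {g : V → ℝ} {g' : V → V}
    {L : ℝ} (hg : ∀ x ∈ s, HasGradientAt g (g' x) x)
    (hL : ∀ x ∈ s, ∀ y ∈ s, ‖g' x - g' y‖ ≤ L * ‖x - y‖) {x y : V} (hx : x ∈ s) (hy : y ∈ s) :
    g x + ⟪g' x, y - x⟫ - L / 2 * ‖y - x‖ ^ 2 ≤ g y := by
  have := le_add_of_lipschitz_gradient hs (g := fun v => -g v) (g' := fun v => -g' v) (L := L)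
    (fun x hx => by
      rw [hasGradientAt_iff_hasFDerivAt, map_neg]
      exact (hg x hx).hasFDerivAt.neg)
    (fun x hx y hy => by
      rw [neg_sub_neg, norm_sub_rev]
      exact hL x hx y hy) hx hy
  rw [inner_neg_left] at this
  linarith

/-- A function with an `L`-Lipschitz gradient is `L`-weakly convex. -/
theorem strongConvexOn_neg_of_lipschitz_gradient {s : Set V} (hs : Convex ℝ s) {g : V → ℝ}
    {g' : V → V} {L : ℝ} (hg : ∀ x ∈ s, HasGradientAt g (g' x) x)
    (hL : ∀ x ∈ s, ∀ y ∈ s, ‖g' x - g' y‖ ≤ L * ‖x - y‖) : StrongConvexOn s (-L) g := by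
  refine ⟨hs, fun x hx y hy a b ha hb hab => ?_⟩
  have hw := hs hx hy ha hb hab
  have h1 := sub_le_of_lipschitz_gradient hs hg hL hw hx
  have h2 := sub_le_of_lipschitz_gradient hs hg hL hw hy
  obtain rfl : a = 1 - b := by linarith
  have e1 : x - ((1 - b) • x + b • y) = b • (x - y) := by module
  have e2 : y - ((1 - b) • x + b • y) = -((1 - b) • (x - y)) := by module
  rw [e1, inner_smul_right, norm_smul, Real.norm_of_nonneg hb] at h1
  rw [e2, inner_neg_right, inner_smul_right, norm_neg, norm_smul, Real.norm_of_nonneg ha] at h2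
  simp only [smul_eq_mul]
  nlinarith [mul_le_mul_of_nonneg_left h1 ha, mul_le_mul_of_nonneg_left h2 hb]

end Convex

/-! ### Existence of minimizers by coercivity, and projections. -/

theorem exists_forall_le_of_quadratic_lower_bound {V : Type*} [NormedAddCommGroup V]
    [ProperSpace V] {s : Set V} (hs : IsClosed s) {g : V → ℝ} (hg : ContinuousOn g s) {u : V} (hu : u ∈ s) {A B m : ℝ}
    (hm : 0 < m) (hlow : ∀ v ∈ s, A - B * ‖v - u‖ + m * ‖v - u‖ ^ 2 ≤ g v) :
    ∃ p ∈ s, ∀ w ∈ s, g p ≤ g w := by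
  refine hg.exists_isMinOn' hs hu ?_
  have h1 : Tendsto (fun v : V => ‖v - u‖) (cocompact V) atTop :=
    tendsto_norm_cocompact_atTop.comp
      (by simpa [sub_eq_add_neg] using
        (Homeomorph.addRight (-u)).isClosedEmbedding.tendsto_cocompact)
  have h2 : Tendsto (fun v : V => A + ‖v - u‖ * (m * ‖v - u‖ - B)) (cocompact V) atTop :=
    tendsto_atTop_add_const_left _ _ (h1.atTop_mul_atTop₀
      (tendsto_atTop_add_const_right _ _ (h1.const_mul_atTop hm)))
  filter_upwards [(h2.eventually_ge_atTop (g u)).filter_mono inf_le_left,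
    mem_inf_of_right (mem_principal_self s)] with v hv hvs
  have := hlow v hvs
  nlinarith

theorem IsProj.inner_le_zero {n : ℕ} {S : Set (E n)} (hS : Convex ℝ S) {u v : E n}
    (h : IsProj S u v) {w : E n} (hw : w ∈ S) : ⟪u - v, w - v⟫ ≤ 0 := by
  refine (norm_eq_iInf_iff_real_inner_le_zero hS h.1).1 (le_antisymm ?_ ?_) w hw
  · have : Nonempty S := ⟨⟨v, h.1⟩⟩
    exact le_ciInf fun w => h.2 w w.2
  · exact ciInf_le ⟨0, by rintro _ ⟨w, rfl⟩; exact norm_nonneg _⟩ (⟨v, h.1⟩ : S)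

/-- A smooth nonconvex-concave problem with compact dual feasible set. -/
structure IsProblem {n d : ℕ} (f : E n → E d → ℝ) (X : Set (E n)) (Y : Set (E d)) (ℓ : ℝ) :
    Prop where
  isClosed_X : IsClosed X
  convex_X : Convex ℝ X
  isCompact_Y : IsCompact Y
  convex_Y : Convex ℝ Y
  nonempty_Y : Y.Nonempty
  smooth : IsSmoothOn f X Y ℓ
  concave : ∀ u ∈ X, ConcaveOn ℝ Y (f u)

/-- The partial gradient in the primal variable. -/
noncomputable abbrev gradX {n d : ℕ} (f : E n → E d → ℝ) (x : E n) (y : E d) : E n :=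
  gradient (fun u => f u y) x

/-- The partial gradient in the dual variable. -/
noncomputable abbrev gradY {n d : ℕ} (f : E n → E d → ℝ) (x : E n) (y : E d) : E d :=
  gradient (fun v => f x v) y

theorem inner_sub_le_of_norm_sub_le {V : Type*} [NormedAddCommGroup V] [InnerProductSpace ℝ V]
    {a b : V} {s : ℝ} (h : ‖a - b‖ ≤ s) (v : V) : ⟪a, v⟫ ≤ ⟪b, v⟫ + s * ‖v‖ := by
  have h1 := real_inner_le_norm (a - b) v
  rw [inner_sub_left] at h1
  nlinarith [mul_le_mul_of_nonneg_right h (norm_nonneg v)]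

/-! ### Gradients, weak convexity and the value function. -/

namespace IsProblem

variable {n d : ℕ} {f : E n → E d → ℝ} {X : Set (E n)} {Y : Set (E d)} {ℓ : ℝ}

theorem hasGradientAt_x (P : IsProblem f X Y ℓ) (x : E n) (y : E d) :
    HasGradientAt (fun u => f u y) (gradX f x y) x := by
  refine DifferentiableAt.hasGradientAt ?_
  have h := P.smooth.contDiff.differentiable one_ne_zero
  exact (h.comp (differentiable_id.prodMk (differentiable_const y))) x

theorem hasGradientAt_y (P : IsProblem f X Y ℓ) (x : E n) (y : E d) :
    HasGradientAt (fun v => f x v) (gradY f x y) y := by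
  refine DifferentiableAt.hasGradientAt ?_
  have h := P.smooth.contDiff.differentiable one_ne_zero
  exact (h.comp ((differentiable_const x).prodMk differentiable_id)) y

theorem hasGradientAt_surrogate_x (P : IsProblem f X Y ℓ) (r : ℝ) (x : E n) (y : E d)
    (z : E n) :
    HasGradientAt (fun u => surrogate f r u y z) (gradX f x y + r • (x - z)) x := by
  rw [hasGradientAt_iff_hasFDerivAt]
  have h2 : HasFDerivAt (fun u : E n => r / 2 * ‖u - z‖ ^ 2)
      ((r / 2) • (2 • (innerSL ℝ (x - z)).comp (ContinuousLinearMap.id ℝ (E n)))) x :=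
    (((hasFDerivAt_id x).sub_const z).norm_sq).const_mul _
  refine ((P.hasGradientAt_x x y).hasFDerivAt.add h2).congr_fderiv ?_
  ext v
  simp
  ring

theorem gradient_surrogate_x (P : IsProblem f X Y ℓ) (r : ℝ) (x : E n) (y : E d) (z : E n) :
    gradient (fun u => surrogate f r u y z) x = gradX f x y + r • (x - z) :=
  (P.hasGradientAt_surrogate_x r x y z).gradient

theorem gradient_surrogate_y (P : IsProblem f X Y ℓ) (r : ℝ) (x : E n) (y : E d) (z : E n) :
    gradient (fun v => surrogate f r x v z) y = gradY f x y :=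
  HasGradientAt.gradient (by
    rw [hasGradientAt_iff_hasFDerivAt]
    exact (P.hasGradientAt_y x y).hasFDerivAt.add_const _)

theorem lipschitz_gradX (P : IsProblem f X Y ℓ) {y : E d} (hy : y ∈ Y) :
    ∀ x ∈ X, ∀ x' ∈ X, ‖gradX f x y - gradX f x' y‖ ≤ ℓ * ‖x - x'‖ := fun x hx x' hx' => by
  simpa using P.smooth.lipschitz_x x hx x' hx' y hy y hy

theorem weaklyConvex (P : IsProblem f X Y ℓ) {y : E d} (hy : y ∈ Y) :
    StrongConvexOn X (-ℓ) fun x => f x y :=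
  strongConvexOn_neg_of_lipschitz_gradient P.convex_X (fun x _ => P.hasGradientAt_x x y)
    (P.lipschitz_gradX hy)

theorem strongConvexOn_surrogate (P : IsProblem f X Y ℓ) {y : E d} (hy : y ∈ Y) (r : ℝ)
    (z : E n) : StrongConvexOn X (r - ℓ) fun x => surrogate f r x y z := by
  have := StrongConvexOn.add_sq_norm_sub (P.weaklyConvex hy) r z
  rwa [neg_add_eq_sub] at this

theorem continuous (P : IsProblem f X Y ℓ) : Continuous fun q : E n × E d => f q.1 q.2 :=
  P.smooth.contDiff.continuous

theorem bddAbove (P : IsProblem f X Y ℓ) (x : E n) : BddAbove ((fun y => f x y) '' Y) :=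
  (P.isCompact_Y.image (P.continuous.comp (Continuous.prodMk_right x))).bddAbove

theorem le_valueFn (P : IsProblem f X Y ℓ) (x : E n) {y : E d} (hy : y ∈ Y) :
    f x y ≤ valueFn f Y x :=
  le_csSup (P.bddAbove x) ⟨y, hy, rfl⟩

theorem valueFn_le (P : IsProblem f X Y ℓ) {x : E n} {B : ℝ} (h : ∀ y ∈ Y, f x y ≤ B) :
    valueFn f Y x ≤ B :=
  csSup_le (P.nonempty_Y.image _) (by rintro _ ⟨y, hy, rfl⟩; exact h y hy)

/-- Weak convexity with a common modulus passes to a pointwise supremum. -/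
theorem weaklyConvex_valueFn (P : IsProblem f X Y ℓ) :
    StrongConvexOn X (-ℓ) (valueFn f Y) := by
  refine ⟨P.convex_X, fun x hx y hy a b ha hb hab => P.valueFn_le fun v hv => ?_⟩
  refine ((P.weaklyConvex hv).2 hx hy ha hb hab).trans ?_
  have h1 := mul_le_mul_of_nonneg_left (P.le_valueFn x hv) ha
  have h2 := mul_le_mul_of_nonneg_left (P.le_valueFn y hv) hb
  simp only [smul_eq_mul]
  linarith

theorem continuous_valueFn (P : IsProblem f X Y ℓ) : Continuous (valueFn f Y) :=
  P.isCompact_Y.continuous_sSup P.continuous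

theorem sSup_surrogate (P : IsProblem f X Y ℓ) (r : ℝ) (x z : E n) :
    sSup ((fun y => surrogate f r x y z) '' Y) = valueFn f Y x + r / 2 * ‖x - z‖ ^ 2 := by
  have : (fun y => surrogate f r x y z) '' Y
      = (fun s => s + r / 2 * ‖x - z‖ ^ 2) '' ((fun y => f x y) '' Y) := by
    rw [image_image]
    rfl
  rw [this]
  exact ((Monotone.map_csSup_of_continuousAt (f := fun s => s + r / 2 * ‖x - z‖ ^ 2)
    (by fun_prop) (fun a b h => by simpa using h) (P.nonempty_Y.image _) (P.bddAbove x))).symm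

/-! ### Minimizers of the surrogate and of the proximal problem. -/

theorem exists_argmin_surrogate (P : IsProblem f X Y ℓ) {r : ℝ} (hr : ℓ < r) (hX : X.Nonempty)
    {y : E d} (hy : y ∈ Y) (z : E n) :
    ∃ p ∈ X, ∀ w ∈ X, surrogate f r p y z ≤ surrogate f r w y z := by
  obtain ⟨u, hu⟩ := hX
  refine exists_forall_le_of_quadratic_lower_bound P.isClosed_X
    (fun x _ => (P.hasGradientAt_surrogate_x r x y z).continuousAt.continuousWithinAt) hu
    (A := surrogate f r u y z) (B := ‖gradX f u y + r • (u - z)‖) (m := (r - ℓ) / 2)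
    (by linarith) fun v hv => ?_
  have h1 := sub_le_of_lipschitz_gradient P.convex_X (fun x _ => P.hasGradientAt_x x y)
    (P.lipschitz_gradX hy) hu hv
  have h2 := neg_le_of_abs_le (abs_real_inner_le_norm (gradX f u y + r • (u - z)) (v - u))
  have h3 : ‖v - z‖ ^ 2 = ‖v - u‖ ^ 2 + 2 * ⟪u - z, v - u⟫ + ‖u - z‖ ^ 2 := by
    rw [← sub_add_sub_cancel v u z, norm_add_sq_real, real_inner_comm]
  rw [inner_add_left, real_inner_smul_left] at h2
  simp only [surrogate] at h1 ⊢
  rw [h3]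
  linarith

/-- Boundedness below of Φ gives coercivity for every m > 0; it serves m = r for p(z) and m = 2ℓ for
the proximal point. -/
theorem exists_argmin_valueFn (P : IsProblem f X Y ℓ) (hB : BddBelow (valueFn f Y '' X))
    (hX : X.Nonempty) {m : ℝ} (hm : 0 < m) (z : E n) :
    ∃ p ∈ X, ∀ w ∈ X,
      valueFn f Y p + m / 2 * ‖p - z‖ ^ 2 ≤ valueFn f Y w + m / 2 * ‖w - z‖ ^ 2 := by
  obtain ⟨u, hu⟩ := hX
  obtain ⟨A, hA⟩ := hB
  refine exists_forall_le_of_quadratic_lower_bound P.isClosed_X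
    (g := fun x => valueFn f Y x + m / 2 * ‖x - z‖ ^ 2)
    (P.continuous_valueFn.add (by fun_prop)).continuousOn hu
    (A := A - m / 2 * ‖u - z‖ ^ 2) (B := 0) (m := m / 4) (by linarith) fun v hv => ?_
  have h1 := hA ⟨v, hv, rfl⟩
  have h2 := norm_sub_le_norm_sub_add_norm_sub v z u
  rw [norm_sub_rev z u] at h2
  have h3 : ‖v - u‖ ^ 2 ≤ 2 * ‖v - z‖ ^ 2 + 2 * ‖u - z‖ ^ 2 := by
    nlinarith [norm_nonneg (v - u), sq_nonneg (‖v - z‖ - ‖u - z‖)]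
  nlinarith

theorem dualFn_eq {r : ℝ} {y : E d} {z p : E n} (hp : p ∈ X)
    (hmin : ∀ w ∈ X, surrogate f r p y z ≤ surrogate f r w y z) :
    dualFn f X r y z = surrogate f r p y z :=
  IsLeast.csInf_eq ⟨⟨p, hp, rfl⟩, by rintro _ ⟨w, hw, rfl⟩; exact hmin w hw⟩

theorem proxFn_eq (P : IsProblem f X Y ℓ) {r : ℝ} {z p : E n} (hp : p ∈ X)
    (hmin : ∀ w ∈ X,
      valueFn f Y p + r / 2 * ‖p - z‖ ^ 2 ≤ valueFn f Y w + r / 2 * ‖w - z‖ ^ 2) :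
    proxFn f X Y r z = valueFn f Y p + r / 2 * ‖p - z‖ ^ 2 := by
  simp only [proxFn, P.sSup_surrogate]
  exact IsLeast.csInf_eq ⟨⟨p, hp, rfl⟩, by rintro _ ⟨w, hw, rfl⟩; exact hmin w hw⟩

/-! ### Stability of minimizers and error bounds. -/

theorem inner_gradX_argmin_nonneg (P : IsProblem f X Y ℓ) {r : ℝ} {y : E d} {z p v : E n}
    (hp : p ∈ X) (hmin : ∀ w ∈ X, surrogate f r p y z ≤ surrogate f r w y z) (hv : v ∈ X) :
    0 ≤ ⟪gradX f p y, v - p⟫ + r * ⟪p - z, v - p⟫ := by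
  have := inner_gradient_sub_nonneg P.convex_X hp hmin (P.hasGradientAt_surrogate_x r p y z) hv
  rwa [inner_add_left, real_inner_smul_left] at this

/-- Test each minimizer's variational inequality at the other and add: the proximal term contributes
-r‖p - p'‖², of which weak convexity costs ℓ‖p - p'‖². -/
theorem norm_argmin_sub_le (P : IsProblem f X Y ℓ) {r : ℝ} (hr : 0 ≤ r) {y y' : E d}
    {z z' p p' : E n} (hy : y ∈ Y) (hy' : y' ∈ Y) (hp : p ∈ X) (hp' : p' ∈ X)
    (hmin : ∀ w ∈ X, surrogate f r p y z ≤ surrogate f r w y z)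
    (hmin' : ∀ w ∈ X, surrogate f r p' y' z' ≤ surrogate f r w y' z') :
    (r - ℓ) * ‖p - p'‖ ≤ ℓ * ‖y - y'‖ + r * ‖z - z'‖ := by
  have h1 := P.inner_gradX_argmin_nonneg hp hmin hp'
  have h2 := P.inner_gradX_argmin_nonneg hp' hmin' hp
  have h3 := inner_sub_le_of_norm_sub_le (P.smooth.lipschitz_x p hp p' hp' y hy y' hy') (p' - p)
  have h4 := mul_le_mul_of_nonneg_left (real_inner_le_norm (z' - z) (p' - p)) hr
  have h5 : ⟪p - z, p' - p⟫ = ⟪p' - z', p' - p⟫ + ⟪z' - z, p' - p⟫ - ‖p' - p‖ ^ 2 := by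
    rw [← real_inner_self_eq_norm_sq, ← inner_add_left, ← inner_sub_left]
    congr 1
    abel
  rw [← neg_sub p' p, inner_neg_right, inner_neg_right] at h2
  rw [h5] at h1
  rw [norm_sub_rev p p', norm_sub_rev z z'] at *
  rcases (norm_nonneg (p' - p)).eq_or_lt with h0 | h0
  · rw [← h0]
    have := P.smooth.pos
    simp only [mul_zero]
    positivity
  · refine le_of_mul_le_mul_right ?_ h0
    nlinarith

/-- The primal error bound for one projected gradient step. -/
theorem norm_step_sub_argmin_le (P : IsProblem f X Y ℓ) {r c : ℝ} (hr : ℓ < r) (hc : 0 < c)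
    (hcr : c * (r + ℓ) ≤ 1) {y : E d} {x u z p : E n} (hx : x ∈ X) (hy : y ∈ Y)
    (hu : IsProj X (x - c • (gradX f x y + r • (x - z))) u) (hp : p ∈ X)
    (hmin : ∀ w ∈ X, surrogate f r p y z ≤ surrogate f r w y z) :
    c * (r - ℓ) * ‖u - p‖ ≤ ‖x - u‖ := by
  have hℓ := P.smooth.pos
  have h1 := mul_nonneg hc.le (P.inner_gradX_argmin_nonneg hp hmin hu.1)
  have h2 := hu.inner_le_zero P.convex_X hp
  have h3 := inner_sub_le_of_norm_sub_le (P.lipschitz_gradX hy p hp x hx) (u - p)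
  have h4 : ‖p - x‖ ≤ ‖x - u‖ + ‖u - p‖ := by
    rw [norm_sub_rev p x]
    exact norm_sub_le_norm_sub_add_norm_sub x u p
  have h5 := mul_le_mul_of_nonneg_left h3 hc.le
  have h6 : ⟪x - c • (gradX f x y + r • (x - z)) - u, p - u⟫
      = - ⟪x - u, u - p⟫ + c * ⟪gradX f x y, u - p⟫ + c * r * ⟪x - u, u - p⟫
        + c * r * ‖u - p‖ ^ 2 + c * r * ⟪p - z, u - p⟫ := by
    rw [← real_inner_self_eq_norm_sq, ← neg_sub u p, inner_neg_right]
    have : x - c • (gradX f x y + r • (x - z)) - u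
      = (x - u) - c • gradX f x y - (c * r) • (x - u) - (c * r) • (u - p) - (c * r) • (p - z) := by
      module
    rw [this]
    simp only [inner_sub_left _ _ (u - p), real_inner_smul_left _ (u - p)]
    ring
  have h7 := real_inner_le_norm (x - u) (u - p)
  -- The bound on c gives 1 - cr ≥ 0. After ‖p - x‖ is split, cr‖u - p‖² absorbs cℓ‖u - p‖² and
  -- leaves the factor c(r - ℓ).
  have h8 := mul_le_mul_of_nonneg_left h7 (show 0 ≤ 1 - c * r by nlinarith)
  have h9 := mul_le_mul_of_nonneg_left h4
    (mul_nonneg (mul_nonneg hc.le hℓ.le) (norm_nonneg (u - p)))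
  rcases (norm_nonneg (u - p)).eq_or_lt with h0 | h0
  · rw [← h0]
    simp
  · refine le_of_mul_le_mul_right ?_ h0
    have h10 : (1 - c * r + c * ℓ) * (‖x - u‖ * ‖u - p‖) ≤ ‖x - u‖ * ‖u - p‖ := by
      refine mul_le_of_le_one_left (by positivity) ?_
      nlinarith
    rw [h6] at h2
    nlinarith

theorem inner_step_y_le (P : IsProblem f X Y ℓ) {α : ℝ} (hα : 0 < α) {g y y' v : E d}
    (hy' : IsProj Y (y + α • g) y') (hv : v ∈ Y) :
    ⟪g, v - y'⟫ ≤ 1 / α * ⟪y' - y, v - y'⟫ := by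
  have h := hy'.inner_le_zero P.convex_Y hv
  have e : y + α • g - y' = α • g - (y' - y) := by abel
  rw [e, inner_sub_left, real_inner_smul_left] at h
  rw [div_mul_eq_mul_div, one_mul, le_div_iff₀ hα]
  linarith

theorem norm_sub_le_diam (P : IsProblem f X Y ℓ) {y v : E d} (hy : y ∈ Y) (hv : v ∈ Y) :
    ‖y - v‖ ≤ Metric.diam Y := by
  rw [← dist_eq_norm]
  exact Metric.dist_le_diam_of_mem P.isCompact_Y.isBounded hy hv

/-- After a projected gradient ascent step, the dual suboptimality is controlled by the step. -/
theorem valueFn_le_of_step_y (P : IsProblem f X Y ℓ) {α : ℝ} (hα : 0 < α) {u x : E n}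
    {y y' : E d} (hu : u ∈ X) (hx : x ∈ X) (hy : y ∈ Y)
    (hy' : IsProj Y (y + α • gradY f u y) y') :
    valueFn f Y x ≤ f x y'
      + Metric.diam Y * ((1 / α + ℓ) * ‖y' - y‖ + ℓ * ‖x - u‖) := by
  refine P.valueFn_le fun v hv => ?_
  have h1 := ConcaveOn.le_add_inner_gradient (P.concave x hx) hy'.1 hv (P.hasGradientAt_y x y')
  have h2 := P.inner_step_y_le hα hy' hv
  have h3 := inner_sub_le_of_norm_sub_le
    (P.smooth.lipschitz_y x hx u hu y' hy'.1 y hy) (v - y')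
  have h4 := mul_le_mul_of_nonneg_left (real_inner_le_norm (y' - y) (v - y'))
    (one_div_nonneg.2 hα.le)
  have h5 := P.norm_sub_le_diam hv hy'.1
  have hℓ := P.smooth.pos
  have h6 : 0 ≤ (1 / α + ℓ) * ‖y' - y‖ + ℓ * ‖x - u‖ := by positivity
  have h7 := mul_le_mul_of_nonneg_right h5 h6
  linarith

/-- The inner minimizer at `y` is close to the outer minimizer if `y` is nearly optimal. -/
theorem sq_norm_argmin_sub_le (P : IsProblem f X Y ℓ) {r : ℝ} {y : E d} {z p q : E n}
    (hy : y ∈ Y) (hp : p ∈ X) (hq : q ∈ X)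
    (hmin : ∀ w ∈ X, surrogate f r p y z ≤ surrogate f r w y z)
    (hqmin : ∀ w ∈ X,
      valueFn f Y q + r / 2 * ‖q - z‖ ^ 2 ≤ valueFn f Y w + r / 2 * ‖w - z‖ ^ 2) :
    (r - ℓ) * ‖q - p‖ ^ 2 ≤ valueFn f Y p - f p y := by
  -- Growth of F(·, y, z) from p to q and growth of the proximal objective from q to p, each with
  -- modulus r - ℓ, are added; f(q, y) ≤ Φ(q) links them.
  have h1 := StrongConvexOn.growth (P.strongConvexOn_surrogate hy r z) hp hmin hq
  have h2 := StrongConvexOn.growth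
    (StrongConvexOn.add_sq_norm_sub P.weaklyConvex_valueFn r z) hq hqmin hp
  have h3 := P.le_valueFn q hy
  rw [norm_sub_rev p q] at h2
  simp only [surrogate] at h1
  linarith

/-! ### One-step decrease of the potential. -/

theorem dual_ascent_y (P : IsProblem f X Y ℓ) {r : ℝ} {y y' : E d} {z p p' : E n}
    (hy : y ∈ Y) (hy' : y' ∈ Y) (hp' : p' ∈ X)
    (hmin : ∀ w ∈ X, surrogate f r p y z ≤ surrogate f r w y z) :
    surrogate f r p y z + ⟪gradY f p' y', y' - y⟫ ≤ surrogate f r p' y' z := by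
  have h1 := ConcaveOn.le_add_inner_gradient (P.concave p' hp') hy' hy (P.hasGradientAt_y p' y')
  -- The gradient is taken at the new pair, so minimality of p tested at p' and concavity suffice;
  -- no smoothness of d is needed.
  have h2 := hmin p' hp'
  rw [← neg_sub y' y, inner_neg_right] at h1
  simp only [surrogate] at *
  linarith

theorem primal_descent (P : IsProblem f X Y ℓ) {r c : ℝ} (hr : 3 * ℓ < r) (hc : 0 < c)
    (hcr : c * (r + ℓ) ≤ 1) {y : E d} {x u z : E n} (hx : x ∈ X) (hy : y ∈ Y)
    (hu : IsProj X (x - c • (gradX f x y + r • (x - z))) u) :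
    surrogate f r u y z + 2 * ℓ * ‖x - u‖ ^ 2 ≤ surrogate f r x y z := by
  have h1 := le_add_of_lipschitz_gradient P.convex_X (fun x _ => P.hasGradientAt_x x y)
    (P.lipschitz_gradX hy) hx hu.1
  have h2 := hu.inner_le_zero P.convex_X hx
  have e1 : x - c • (gradX f x y + r • (x - z)) - u
      = (x - u) - c • (gradX f x y + r • (x - z)) := by abel
  have e2 : ‖u - z‖ ^ 2 = ‖x - z‖ ^ 2 - 2 * ⟪x - z, x - u⟫ + ‖x - u‖ ^ 2 := by
    rw [← norm_sub_sq_real]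
    congr 2
    abel
  rw [e1, inner_sub_left, real_inner_self_eq_norm_sq, real_inner_smul_left, inner_add_left,
    real_inner_smul_left] at h2
  rw [← neg_sub x u, inner_neg_right, norm_neg] at h1
  -- Half of this gain pays for the curvature of F; the other half, (r + ℓ)/2, exceeds 2ℓ.
  have h3 : (r + ℓ) * ‖x - u‖ ^ 2 ≤ ⟪gradX f x y, x - u⟫ + r * ⟪x - z, x - u⟫ := by
    refine le_of_mul_le_mul_left ?_ hc
    nlinarith [sq_nonneg ‖x - u‖]
  simp only [surrogate]
  rw [e2]
  nlinarith [sq_nonneg ‖x - u‖]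

/-- The budget of one iteration: the right side holds the gains of the three steps plus the residue,
the left side the decrease to be kept plus the cross terms. Here δ, η, w are the lengths ‖x - u‖,
‖y' - y‖, ‖u - z‖; G, e, s are the distances q to p₁, p₁ to u, u to p in `potential_step`. -/
theorem descent_arith {ℓ r c α β M D δ η w G e s : ℝ} (hℓ : 0 < ℓ) (hr : 3 * ℓ < r)
    (hc : 0 < c) (hα : 0 < α) (hα₁ : α ≤ 1 / (11 * ℓ))
    (hα₂ : α ≤ c ^ 2 * (r - ℓ) ^ 2 / (4 * ℓ * (1 + c * (r - ℓ)) ^ 2))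
    (hβ : 0 < β) (hβ₁ : β ≤ 1 / 36) (hM : 1 / α + 3 / 2 * ℓ ≤ M * ℓ) (hM' : 1 ≤ M * (c * (r - ℓ)))
    (hD : 0 ≤ D) (hη : 0 ≤ η) (hs : 0 ≤ s)
    (he : e ≤ η / 2 + s) (hsδ : c * (r - ℓ) * s ≤ δ)
    (hG : (r - ℓ) * G ^ 2 ≤ D * ((1 / α + ℓ) * η + ℓ * e)) :
    ℓ / 2 * δ ^ 2 + ℓ / 2 * η ^ 2 + ℓ * β * w ^ 2 + 2 * r * β * w * G + 3 * r * β ^ 2 * w ^ 2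
        + 2 * ℓ * (e + η) * η
      ≤ 2 * ℓ * δ ^ 2 + 1 / α * η ^ 2 + r * β * (1 - β / 2) * w ^ 2
        + 9 * M ^ 2 * ℓ * β ^ 2 * D ^ 2 := by
  have hμ : 0 < r - ℓ := by linarith
  have hcμ : 0 < c * (r - ℓ) := mul_pos hc hμ
  have h1 : 11 * ℓ ≤ 1 / α := by
    rw [le_div_iff₀ hα]
    rw [le_div_iff₀ (by positivity)] at hα₁
    linarith
  have h2 : 4 * α * ℓ ^ 2 * s ^ 2 ≤ ℓ * δ ^ 2 := by
    rw [le_div_iff₀ (by positivity)] at hα₂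
    have h3 : α * (4 * ℓ) ≤ (c * (r - ℓ)) ^ 2 := by
      refine le_trans ?_ (hα₂.trans_eq (by ring))
      have : 1 ≤ (1 + c * (r - ℓ)) ^ 2 := one_le_pow₀ (by linarith)
      have h0 : 0 ≤ α * (4 * ℓ) := by positivity
      linarith [mul_le_mul_of_nonneg_left this h0]
    have h4 : (c * (r - ℓ) * s) ^ 2 ≤ δ ^ 2 := pow_le_pow_left₀ (by positivity) hsδ 2
    linarith [mul_le_mul_of_nonneg_right h3 (mul_nonneg hℓ.le (sq_nonneg s)),
      mul_le_mul_of_nonneg_left h4 hℓ.le]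
  have h5 : 2 * ℓ * s * η ≤ 1 / α / 4 * η ^ 2 + 4 * α * ℓ ^ 2 * s ^ 2 := by
    have : 1 / α / 4 * η ^ 2 + 4 * α * ℓ ^ 2 * s ^ 2 - 2 * ℓ * s * η
        = α * (η / α - 4 * ℓ * s) ^ 2 / 4 := by
      field_simp
      ring
    have h : 0 ≤ α * (η / α - 4 * ℓ * s) ^ 2 / 4 := by positivity
    linarith
  have h6 : 2 * ℓ * (e + η) * η ≤ 3 * ℓ * η ^ 2 + 2 * ℓ * s * η := by
    linarith [mul_le_mul_of_nonneg_right he (mul_nonneg hℓ.le hη)]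
  have h7 : s ≤ M * δ := by
    have hM0 : 0 ≤ M := le_of_mul_le_mul_right (a := ℓ) (by linarith) hℓ
    calc s = 1 * s := (one_mul s).symm
      _ ≤ M * (c * (r - ℓ)) * s := mul_le_mul_of_nonneg_right hM' hs
      _ = M * (c * (r - ℓ) * s) := by ring
      _ ≤ M * δ := mul_le_mul_of_nonneg_left hsδ hM0
  have h8 : (r - ℓ) * G ^ 2 ≤ D * (M * ℓ * (η + δ)) := by
    refine hG.trans (mul_le_mul_of_nonneg_left ?_ hD)
    linarith [mul_le_mul_of_nonneg_right hM hη, mul_le_mul_of_nonneg_left h7 hℓ.le,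
      mul_le_mul_of_nonneg_left he hℓ.le]
  -- Young's inequality, then 2r ≤ 3(r - ℓ), which is r ≥ 3ℓ.
  have h9 : 2 * r * β * w * G ≤ r * β * w ^ 2 / 2 + 3 * β * ((r - ℓ) * G ^ 2) := by
    have a1 : 0 ≤ r * β * (w - 2 * G) ^ 2 := by
      have : 0 < r := by linarith
      positivity
    have a2 : 0 ≤ β * G ^ 2 * (r - 3 * ℓ) :=
      mul_nonneg (by positivity) (by linarith)
    linarith
  -- The bound on G² is linear in η + δ, so completing squares leaves a constant: the source of the
  -- β²D² residue.
  have h10 : 3 * β * (D * (M * ℓ * (η + δ)))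
      ≤ ℓ / 2 * η ^ 2 + ℓ / 2 * δ ^ 2 + 9 * M ^ 2 * ℓ * β ^ 2 * D ^ 2 := by
    linarith [mul_nonneg hℓ.le (sq_nonneg (η - 3 * β * D * M)),
      mul_nonneg hℓ.le (sq_nonneg (δ - 3 * β * D * M))]
  have h11 := mul_le_mul_of_nonneg_left h8 (show 0 ≤ 3 * β by linarith)
  have h12 : ℓ * β * w ^ 2 + 3 * r * β ^ 2 * w ^ 2 + r * β * w ^ 2 / 2
      ≤ r * β * (1 - β / 2) * w ^ 2 := by
    have a1 : ℓ + 3 * r * β + r / 2 ≤ r * (1 - β / 2) := by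
      linarith [mul_le_mul_of_nonneg_left hβ₁ (show 0 ≤ r by linarith)]
    linarith [mul_le_mul_of_nonneg_right a1 (mul_nonneg hβ.le (sq_nonneg w))]
  have h13 := mul_le_mul_of_nonneg_right h1 (sq_nonneg η)
  linarith [mul_nonneg hℓ.le (sq_nonneg η)]

/-- The minimizers p, p₁, p₂ belong to (y, z), (y', z), (y', z'), and q, q' to p(z), p(z'). Changes
of d and p in z are bounded by testing minimality at p₂ and q, which avoids differentiating either
function. -/
theorem potential_step (P : IsProblem f X Y ℓ) (hB : BddBelow (valueFn f Y '' X))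
    {r c α β M : ℝ} (hr : 3 * ℓ < r) (hc : 0 < c) (hcr : c * (r + ℓ) ≤ 1)
    (hα : 0 < α) (hα₁ : α ≤ 1 / (11 * ℓ))
    (hα₂ : α ≤ c ^ 2 * (r - ℓ) ^ 2 / (4 * ℓ * (1 + c * (r - ℓ)) ^ 2))
    (hβ : 0 < β) (hβ₁ : β ≤ 1 / 36) (hM : 1 / α + 3 / 2 * ℓ ≤ M * ℓ) (hM' : 1 ≤ M * (c * (r - ℓ)))
    {y y' : E d} {x u z : E n} (hx : x ∈ X) (hy : y ∈ Y)
    (hu : IsProj X (x - c • (gradX f x y + r • (x - z))) u)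
    (hy' : IsProj Y (y + α • gradY f u y) y') :
    potential f X Y r u y' (z + β • (u - z)) + (ℓ / 2 * ‖x - u‖ ^ 2 + ℓ / 2 * ‖y' - y‖ ^ 2
        + ℓ * β * ‖u - z‖ ^ 2)
      ≤ potential f X Y r x y z + 9 * M ^ 2 * ℓ * β ^ 2 * Metric.diam Y ^ 2 := by
  have hℓ := P.smooth.pos
  have hr0 : 0 < r := by linarith
  have hX : X.Nonempty := ⟨x, hx⟩
  set z' := z + β • (u - z) with hz'
  obtain ⟨p, hp, hpm⟩ := P.exists_argmin_surrogate (r := r) (by linarith) hX hy z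
  obtain ⟨p₁, hp₁, hpm₁⟩ := P.exists_argmin_surrogate (r := r) (by linarith) hX hy'.1 z
  obtain ⟨p₂, hp₂, hpm₂⟩ := P.exists_argmin_surrogate (r := r) (by linarith) hX hy'.1 z'
  obtain ⟨q, hq, hqm⟩ := P.exists_argmin_valueFn hB hX hr0 z
  obtain ⟨q', hq', hqm'⟩ := P.exists_argmin_valueFn hB hX hr0 z'
  have ha := P.primal_descent hr hc hcr hx hy hu
  have hb := ConcaveOn.le_add_inner_gradient (P.concave u hu.1) hy hy'.1 (P.hasGradientAt_y u y)
  have hcz : ‖u - z'‖ ^ 2 = (1 - β) ^ 2 * ‖u - z‖ ^ 2 := by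
    have : u - z' = (1 - β) • (u - z) := by rw [hz']; module
    rw [this, norm_smul, mul_pow, Real.norm_eq_abs, sq_abs]
  have hd := P.dual_ascent_y hy hy'.1 hp₁ hpm
  have hd' := inner_sub_le_of_norm_sub_le
    (P.smooth.lipschitz_y u hu.1 p₁ hp₁ y hy y' hy'.1) (y' - y)
  have he := hpm₁ p₂ hp₂
  have hf := hqm' q hq
  have hinner : ‖p₂ - z‖ ^ 2 - ‖p₂ - z'‖ ^ 2 + ‖q - z'‖ ^ 2 - ‖q - z‖ ^ 2
      = 2 * β * ⟪u - z, p₂ - q⟫ := by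
    have e1 : p₂ - z' = (p₂ - z) - β • (u - z) := by rw [hz']; abel
    have e2 : q - z' = (q - z) - β • (u - z) := by rw [hz']; abel
    have e3 : p₂ - q = (p₂ - z) - (q - z) := by abel
    rw [e1, e2, e3, inner_sub_right (u - z), real_inner_comm (p₂ - z), real_inner_comm (q - z),
      norm_sub_sq_real (p₂ - z), norm_sub_sq_real (q - z), real_inner_smul_right,
      real_inner_smul_right]
    ring
  have hCS := real_inner_le_norm (u - z) (p₂ - q)
  have hp₂q : ‖p₂ - q‖ ≤ ‖q - p₁‖ + 3 / 2 * β * ‖u - z‖ := by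
    have h1 := P.norm_argmin_sub_le hr0.le hy'.1 hy'.1 hp₁ hp₂ hpm₁ hpm₂
    have h2 := norm_sub_le_norm_sub_add_norm_sub q p₁ p₂
    have h3 : ‖z - z'‖ = β * ‖u - z‖ := by
      rw [hz', sub_add_cancel_left, norm_neg, norm_smul, Real.norm_of_nonneg hβ.le]
    rw [sub_self, norm_zero, mul_zero, zero_add, h3] at h1
    rw [norm_sub_rev p₂ q]
    have h4 : 0 ≤ β * ‖u - z‖ := by positivity
    -- The factor 3/2 bounds r/(r - ℓ) when r > 3ℓ; likewise 1/2 bounds ℓ/(r - ℓ) for p and p₁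
    -- below.
    have h5 : (r - ℓ) * ‖p₁ - p₂‖ ≤ (r - ℓ) * (3 / 2 * (β * ‖u - z‖)) := by
      linarith [mul_nonneg (sub_nonneg.2 hr.le) h4]
    linarith [le_of_mul_le_mul_left h5 (by linarith)]
  have hg := P.inner_step_y_le hα hy' hy
  rw [← neg_sub y' y, inner_neg_right, inner_neg_right, real_inner_self_eq_norm_sq] at hg
  have hs := P.norm_step_sub_argmin_le (by linarith) hc hcr hx hy hu hp hpm
  have hpp₁ : ‖p - p₁‖ ≤ ‖y' - y‖ / 2 := by
    have h1 := P.norm_argmin_sub_le hr0.le hy hy'.1 hp hp₁ hpm hpm₁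
    rw [sub_self, norm_zero, mul_zero, add_zero, norm_sub_rev y y'] at h1
    have h4 : 0 ≤ ‖y' - y‖ := norm_nonneg _
    have h5 : (r - ℓ) * ‖p - p₁‖ ≤ (r - ℓ) * (‖y' - y‖ / 2) := by
      linarith [mul_nonneg (sub_nonneg.2 hr.le) h4]
    exact le_of_mul_le_mul_left h5 (by linarith)
  have he' : ‖p₁ - u‖ ≤ ‖y' - y‖ / 2 + ‖u - p‖ := by
    have := norm_sub_le_norm_sub_add_norm_sub u p p₁
    rw [norm_sub_rev p₁ u]
    linarith
  have hG := (P.sq_norm_argmin_sub_le hy'.1 hp₁ hq hpm₁ hqm).trans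
    (sub_le_iff_le_add'.2 (P.valueFn_le_of_step_y hα hu.1 hp₁ hy hy'))
  have key := descent_arith (w := ‖u - z‖) hℓ hr hc hα hα₁ hα₂ hβ hβ₁ hM hM' Metric.diam_nonneg
    (norm_nonneg (y' - y)) (norm_nonneg (u - p)) he' hs hG
  have hwG : r * β * ⟪u - z, p₂ - q⟫
      ≤ r * β * ‖u - z‖ * ‖q - p₁‖ + 3 / 2 * r * β ^ 2 * ‖u - z‖ ^ 2 := by
    have h1 := hCS.trans (mul_le_mul_of_nonneg_left hp₂q (norm_nonneg _))
    have h2 := mul_le_mul_of_nonneg_left h1 (mul_pos hr0 hβ).le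
    linarith
  rw [norm_sub_rev u p₁, norm_sub_rev y y'] at hd'
  simp only [potential]
  rw [dualFn_eq hp hpm, dualFn_eq hp₂ hpm₂, P.proxFn_eq hq hqm, P.proxFn_eq hq' hqm']
  simp only [surrogate] at *
  rw [hcz]
  have hinner' : r * _ = r * _ := congrArg (r * ·) hinner
  linarith

/-- Ψ = (F - d) + (p - d) + p, where the first two terms are nonnegative and p ≥ inf Φ. -/
theorem sInf_valueFn_le_potential (P : IsProblem f X Y ℓ) (hB : BddBelow (valueFn f Y '' X))
    {r : ℝ} (hr : ℓ < r) {x z : E n} {y : E d} (hx : x ∈ X) (hy : y ∈ Y) :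
    sInf (valueFn f Y '' X) ≤ potential f X Y r x y z := by
  have hℓ := P.smooth.pos
  have hr0 : 0 < r := by linarith
  obtain ⟨p, hp, hpm⟩ := P.exists_argmin_surrogate hr ⟨x, hx⟩ hy z
  obtain ⟨q, hq, hqm⟩ := P.exists_argmin_valueFn hB ⟨x, hx⟩ hr0 z
  have h1 := csInf_le hB ⟨q, hq, rfl⟩
  have h2 := hpm x hx
  have h3 := hpm q hq
  have h4 := P.le_valueFn q hy
  have h5 : 0 ≤ r / 2 * ‖q - z‖ ^ 2 := by positivity
  simp only [potential]
  rw [dualFn_eq hp hpm, P.proxFn_eq hq hqm]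
  simp only [surrogate] at *
  linarith

/-! ### From small steps to stationarity. -/

theorem exists_residual_x (P : IsProblem f X Y ℓ) {r c : ℝ} (hr : 0 ≤ r) (hc : 0 < c)
    {y y' : E d} {x u z : E n} (hx : x ∈ X) (hy : y ∈ Y) (hy' : y' ∈ Y)
    (hu : IsProj X (x - c • (gradX f x y + r • (x - z))) u) :
    ∃ v ∈ normalCone X u, ‖gradX f u y' + v‖
      ≤ (ℓ + r + 1 / c) * ‖x - u‖ + ℓ * ‖y' - y‖ + r * ‖u - z‖ := by
  -- The projection defect divided by c is a normal vector at u.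
  refine ⟨(1 / c) • (x - u) - (gradX f x y + r • (x - z)), fun w hw => ?_, ?_⟩
  · have h := hu.inner_le_zero P.convex_X hw
    have e : (1 / c) • (x - u) - (gradX f x y + r • (x - z))
        = (1 / c) • (x - c • (gradX f x y + r • (x - z)) - u) := by
      rw [sub_right_comm, smul_sub _ (x - u), smul_smul, one_div_mul_cancel hc.ne', one_smul]
    rw [e, real_inner_smul_left]
    exact mul_nonpos_of_nonneg_of_nonpos (one_div_nonneg.2 hc.le) h
  · have e : gradX f u y' + ((1 / c) • (x - u) - (gradX f x y + r • (x - z)))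
        = (gradX f u y' - gradX f x y) + (1 / c) • (x - u) - r • (x - u) - r • (u - z) := by
      module
    have h1 := P.smooth.lipschitz_x u hu.1 x hx y' hy' y hy
    have h2 := norm_sub_le ((gradX f u y' - gradX f x y) + (1 / c) • (x - u) - r • (x - u))
      (r • (u - z))
    have h3 := norm_sub_le ((gradX f u y' - gradX f x y) + (1 / c) • (x - u)) (r • (x - u))
    have h4 := norm_add_le (gradX f u y' - gradX f x y) ((1 / c) • (x - u))
    rw [norm_smul, Real.norm_of_nonneg hr] at h2 h3
    rw [norm_smul, Real.norm_of_nonneg (one_div_nonneg.2 hc.le)] at h4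
    rw [norm_sub_rev u x] at h1
    rw [e]
    linarith

theorem exists_residual_y (P : IsProblem f X Y ℓ) {α : ℝ} (hα : 0 < α) {y y' : E d} {u : E n}
    (hu : u ∈ X) (hy : y ∈ Y) (hy' : IsProj Y (y + α • gradY f u y) y') :
    ∃ v ∈ normalCone Y y', ‖-gradY f u y' + v‖ ≤ (1 / α + ℓ) * ‖y' - y‖ := by
  refine ⟨gradY f u y - (1 / α) • (y' - y), fun w hw => ?_, ?_⟩
  · have h := P.inner_step_y_le hα hy' hw
    rw [inner_sub_left, real_inner_smul_left]
    linarith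
  · have h1 := P.smooth.lipschitz_y u hu u hu y hy y' hy'.1
    have h2 := norm_sub_le (gradY f u y - gradY f u y') ((1 / α) • (y' - y))
    rw [norm_smul, Real.norm_of_nonneg (one_div_nonneg.2 hα.le)] at h2
    rw [sub_self, norm_zero, zero_add, norm_sub_rev y y'] at h1
    have e : -gradY f u y' + (gradY f u y - (1 / α) • (y' - y))
        = gradY f u y - gradY f u y' - (1 / α) • (y' - y) := by abel
    rw [e]
    linarith

/-- Game stationarity together with a small dual gap gives optimization stationarity. -/
theorem isOS_of_residual (P : IsProblem f X Y ℓ) (hB : BddBelow (valueFn f Y '' X)) {ε : ℝ}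
    (hε : 0 < ε) {u v : E n} {y : E d} (hu : u ∈ X) (hy : y ∈ Y) (hv : v ∈ normalCone X u)
    (hx : ‖gradX f u y + v‖ ≤ ε / 8) (hgap : valueFn f Y u ≤ f u y + ε ^ 2 / (16 * ℓ)) :
    IsOS f X Y ℓ ε u := by
  have hℓ := P.smooth.pos
  obtain ⟨p, hp, hpm⟩ := P.exists_argmin_valueFn hB ⟨u, hu⟩ (m := 2 * ℓ) (by linarith) u
  have hgrow : ∀ w ∈ X, _ := fun w hw =>
    StrongConvexOn.growth (StrongConvexOn.add_sq_norm_sub P.weaklyConvex_valueFn (2 * ℓ) u)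
      hp hpm hw
  have hs : 1 / (2 * (1 / (2 * ℓ))) = 2 * ℓ / 2 := by field_simp
  refine ⟨hu, p, ?_, ?_⟩
  · ext w
    simp only [proxSet, hs, mem_ofPred_eq, mem_singleton_iff]
    refine ⟨fun hw => ?_, ?_⟩
    · have h1 := hgrow w hw.1
      have h2 := hw.2 p hp
      have h3 : ‖w - p‖ ^ 2 ≤ 0 := by
        refine le_of_mul_le_mul_left (a := ℓ) ?_ hℓ
        linarith
      have h4 : ‖w - p‖ = 0 := by
        have := norm_nonneg (w - p)
        exact pow_eq_zero_iff two_ne_zero |>.1 (le_antisymm h3 (sq_nonneg _))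
      exact sub_eq_zero.1 (norm_eq_zero.1 h4)
    · rintro rfl
      exact ⟨hp, hpm⟩
  · have h1 := hgrow u hu
    simp only [sub_self, norm_zero] at h1
    rw [norm_sub_rev u p] at h1
    have h2 := P.le_valueFn p hy
    have h3 := sub_le_of_lipschitz_gradient P.convex_X (fun x _ => P.hasGradientAt_x x y)
      (P.lipschitz_gradX hy) hu hp
    have h4 := hv p hp
    have h5 := neg_le_of_abs_le (abs_real_inner_le_norm (gradX f u y + v) (p - u))
    have h6 := mul_le_mul_of_nonneg_right hx (norm_nonneg (p - u))
    rw [inner_add_left] at h5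
    -- Growth supplies 3ℓ/2 in total, and weak convexity of f(·, y) takes back ℓ/2.
    have h7 : ℓ * ‖p - u‖ ^ 2 ≤ ε / 8 * ‖p - u‖ + ε ^ 2 / (16 * ℓ) := by linarith
    rw [le_div_iff₀ (by positivity)]
    have h8 : ε ^ 2 / (16 * ℓ) * (16 * ℓ) = ε ^ 2 := div_mul_cancel₀ _ (by positivity)
    by_contra! h9
    have h10 := norm_nonneg (p - u)
    nlinarith [mul_le_mul_of_nonneg_right h7 (show 0 ≤ 16 * ℓ by linarith)]

theorem isGS_and_isOS_of_step (P : IsProblem f X Y ℓ) (hB : BddBelow (valueFn f Y '' X))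
    {r c α ε : ℝ} (hr : 0 ≤ r) (hc : 0 < c) (hα : 0 < α) (hε : 0 < ε)
    {y y' : E d} {x u z : E n} (hx : x ∈ X) (hy : y ∈ Y)
    (hu : IsProj X (x - c • (gradX f x y + r • (x - z))) u)
    (hy' : IsProj Y (y + α • gradY f u y) y')
    (h₁ : (ℓ + r + 1 / c) * ‖x - u‖ + ℓ * ‖y' - y‖ + r * ‖u - z‖ ≤ ε / 8)
    (h₂ : (1 / α + ℓ) * ‖y' - y‖ ≤ ε / 8)
    (h₃ : Metric.diam Y * ((1 / α + ℓ) * ‖y' - y‖) ≤ ε ^ 2 / (16 * ℓ)) :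
    IsGS f X Y ε u y' ∧ IsOS f X Y ℓ ε u := by
  obtain ⟨v, hv, hv'⟩ := P.exists_residual_x hr hc hx hy hy'.1 hu
  obtain ⟨w, hw, hw'⟩ := P.exists_residual_y hα hu.1 hy hy'
  refine ⟨⟨hu.1, hy'.1, ?_, ?_⟩, ?_⟩
  · refine (Metric.infDist_le_dist_of_mem (mem_image_of_mem _ hv)).trans ?_
    rw [dist_zero_left]
    linarith
  · refine (Metric.infDist_le_dist_of_mem (mem_image_of_mem _ hw)).trans ?_
    rw [dist_zero_left]
    linarith
  · refine P.isOS_of_residual hB hε hu.1 hy'.1 hv (hv'.trans h₁) ?_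
    have h := P.valueFn_le_of_step_y hα hu.1 hu.1 hy hy'
    rw [sub_self, norm_zero, mul_zero, add_zero] at h
    linarith

end IsProblem

theorem le_of_mul_sq_le {ℓ h σ ε δ : ℝ} (hℓ : 0 < ℓ) (hh : 0 ≤ h) (hσ : 0 ≤ σ) (hε : 0 < ε)
    (hδ : ℓ * δ ^ 2 ≤ 4 * (h ^ 2 * σ ^ 2 * ε ^ 2 / ℓ)) : δ ≤ 2 * h * σ * ε / ℓ := by
  refine le_of_abs_le (abs_le_of_sq_le_sq ?_ (by positivity))
  refine le_of_mul_le_mul_left (hδ.trans_eq ?_) hℓ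
  field_simp
  ring

/-- The weight β on w² gives w = O(ε/ℓ) only, whereas δ and η gain a factor √β. That factor, at most
ε/(2ℓD), brings the dual gap D·O(ℓη) down to order ε²/ℓ. -/
theorem stationarity_arith {ℓ r c α β ε D κ γ a N δ η w : ℝ} (hℓ : 0 < ℓ) (hr : 0 < r)
    (hc : 0 < c) (hβ : 0 < β) (hβ₁ : β ≤ 1) (hε : 0 < ε) (hD : 0 < D)
    (hN : 0 < N) (hNdef : N = 2 * κ + 2 + 1 / γ + 1 / a) (hγ : 0 < γ) (ha : 0 < a)
    (hrκ : r ≤ κ * ℓ) (hcγ : 1 / c ≤ 1 / γ * ℓ) (hαa : 1 / α ≤ 1 / a * ℓ)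
    (hβD : β ≤ 1 / 4 * (ε ^ 2 / (ℓ ^ 2 * D ^ 2)))
    (hη0 : 0 ≤ η)
    (hlt : ℓ / 2 * δ ^ 2 + ℓ / 2 * η ^ 2 + ℓ * β * w ^ 2
      ≤ 2 * ((1 / (16 * N)) ^ 2 * β * ε ^ 2 / ℓ)) :
    (ℓ + r + 1 / c) * δ + ℓ * η + r * w ≤ ε / 8 ∧ (1 / α + ℓ) * η ≤ ε / 8 ∧
      D * ((1 / α + ℓ) * η) ≤ ε ^ 2 / (16 * ℓ) := by
  set h := 1 / (16 * N) with hh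
  have hh0 : 0 < h := by positivity
  have hNh : N * h = 1 / 16 := by rw [hh]; field_simp
  have hσ0 := Real.sqrt_nonneg β
  have hσβ := Real.sq_sqrt hβ.le
  set σ := Real.sqrt β
  have hσ1 : σ ≤ 1 := Real.sqrt_le_one.2 hβ₁
  have e1 : 0 ≤ ℓ / 2 * δ ^ 2 := by positivity
  have e2 : 0 ≤ ℓ / 2 * η ^ 2 := by positivity
  have e3 : 0 ≤ ℓ * β * w ^ 2 := by positivity
  have hδ : δ ≤ 2 * h * σ * ε / ℓ :=
    le_of_mul_sq_le hℓ hh0.le hσ0 hε (by rw [hσβ]; linarith)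
  have hη : η ≤ 2 * h * σ * ε / ℓ :=
    le_of_mul_sq_le hℓ hh0.le hσ0 hε (by rw [hσβ]; linarith)
  have hw : w ≤ 2 * h * 1 * ε / ℓ := by
    refine le_of_mul_sq_le hℓ hh0.le zero_le_one hε ?_
    refine le_of_mul_le_mul_left ?_ hβ
    have : 0 ≤ h ^ 2 * β * ε ^ 2 / ℓ := by positivity
    calc β * (ℓ * w ^ 2) = ℓ * β * w ^ 2 := by ring
      _ ≤ 4 * (h ^ 2 * β * ε ^ 2 / ℓ) := by linarith
      _ = β * (4 * (h ^ 2 * 1 ^ 2 * ε ^ 2 / ℓ)) := by ring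
  set S := 2 * h * ε / ℓ with hS
  have hS0 : 0 < S := by positivity
  have hδS : δ ≤ σ * S := hδ.trans_eq (by rw [hS]; ring)
  have hηS : η ≤ σ * S := hη.trans_eq (by rw [hS]; ring)
  have hwS : w ≤ S := hw.trans_eq (by rw [hS]; ring)
  have hσS : σ * S ≤ S := mul_le_of_le_one_left hS0.le hσ1
  have hNS : N * ℓ * S = ε / 8 := by
    have : N * ℓ * S = 2 * (N * h) * ε * (ℓ / ℓ) := by rw [hS]; ring
    rw [this, hNh, div_self hℓ.ne']
    ring
  have hγ' : 0 < 1 / γ := by positivity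
  have ha' : 0 < 1 / a := by positivity
  have hy : (1 / α + ℓ) * η ≤ σ * (ε / 8) := by
    have : 1 / α + ℓ ≤ N * ℓ := by
      rw [hNdef]
      linarith [mul_pos hγ' hℓ]
    calc (1 / α + ℓ) * η ≤ (N * ℓ) * (σ * S) := mul_le_mul this hηS hη0 (by positivity)
      _ = σ * (ε / 8) := by rw [← hNS]; ring
  refine ⟨?_, hy.trans (mul_le_of_le_one_left (by positivity) hσ1), ?_⟩
  · have hc' : 0 < 1 / c := by positivity
    have f1 := mul_le_mul_of_nonneg_left (hδS.trans hσS) (show 0 ≤ ℓ + r + 1 / c by positivity)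
    have f2 := mul_le_mul_of_nonneg_left (hηS.trans hσS) hℓ.le
    have f3 := mul_le_mul_of_nonneg_left hwS hr.le
    have f4 : ℓ + r + 1 / c + ℓ + r ≤ N * ℓ := by
      rw [hNdef]
      linarith [mul_pos ha' hℓ]
    have f5 := mul_le_mul_of_nonneg_right f4 hS0.le
    linarith
  · have hDσ : σ ≤ ε / (2 * ℓ * D) := by
      refine le_of_abs_le (abs_le_of_sq_le_sq ?_ (by positivity))
      rw [hσβ]
      refine hβD.trans_eq ?_
      field_simp
      ring
    calc D * ((1 / α + ℓ) * η) ≤ D * (ε / (2 * ℓ * D) * (ε / 8)) :=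
          mul_le_mul_of_nonneg_left (hy.trans (mul_le_mul_of_nonneg_right hDσ (by positivity))) hD.le
      _ = ε ^ 2 / (16 * ℓ) := by field_simp; ring

end MinimaxNCC

/-! ### Choice of constants and counting of iterations. -/

open MinimaxNCC in
theorem mainTheorem7 :
    -- constants hidden in `r = Θ(ℓ)`, `c = Θ(1/ℓ)`, `α = Θ(1/ℓ)`
    ∀ κ γ a : ℝ, 0 < κ → 0 < γ → 0 < a →
    -- constants `b₁ ≤ b₀` hidden in `β = Θ(ε² / (ℓ² D²))`, and `C` of the iteration bound
    ∃ b₀ : ℝ, 0 < b₀ ∧ ∀ b₁ : ℝ, 0 < b₁ → ∃ C : ℝ, 0 < C ∧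
    ∀ (n d : ℕ) (f : MinimaxNCC.E n → MinimaxNCC.E d → ℝ)
      (X : Set (MinimaxNCC.E n)) (Y : Set (MinimaxNCC.E d)) (ℓ ε r c α β : ℝ)
      (x : ℕ → MinimaxNCC.E n) (y : ℕ → MinimaxNCC.E d) (z : ℕ → MinimaxNCC.E n),
      IsClosed X → Convex ℝ X →
      IsCompact Y → Convex ℝ Y → 0 < Metric.diam Y →
      MinimaxNCC.IsSmoothOn f X Y ℓ →
      (∀ u ∈ X, ConcaveOn ℝ Y (f u)) →
      BddBelow (MinimaxNCC.valueFn f Y '' X) →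
      0 < ε →
      MinimaxNCC.StepSizes κ γ a ℓ r c α β →
      b₁ * (ε ^ 2 / (ℓ ^ 2 * Metric.diam Y ^ 2)) ≤ β →
      β ≤ b₀ * (ε ^ 2 / (ℓ ^ 2 * Metric.diam Y ^ 2)) →
      MinimaxNCC.IsSmoothedGDA f X Y r c α β x y z →
      ∃ t : ℕ,
        (t : ℝ) ≤ C * (ℓ ^ 3 * Metric.diam Y ^ 2 *
          MinimaxNCC.initialGap f X Y r (x 0) (y 0) (z 0) / ε ^ 4) ∧
        MinimaxNCC.IsGS f X Y ε (x (t + 1)) (y (t + 1)) ∧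
        MinimaxNCC.IsOS f X Y ℓ ε (x (t + 1)) := by
  intro κ γ a hκ hγ ha
  obtain ⟨M, hMdef⟩ : ∃ M, M = 1 / a + 3 / 2 + 1 / (2 * γ) := ⟨_, rfl⟩
  obtain ⟨N, hNdef⟩ : ∃ N, N = 2 * κ + 2 + 1 / γ + 1 / a := ⟨_, rfl⟩
  have hM0 : 0 < M := by rw [hMdef]; positivity
  have hN0 : 0 < N := by rw [hNdef]; positivity
  set θ := (1 / (16 * N)) ^ 2 with hθ
  have hθ0 : 0 < θ := by positivity
  -- The bound 1/4 yields √β ≤ ε/(2ℓD); θ/(9M²) makes the residue at most θβε²/ℓ.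
  refine ⟨min (1 / 4) (θ / (9 * M ^ 2)), by positivity, fun b₁ hb₁ =>
    ⟨1 / (θ * b₁), by positivity, ?_⟩⟩
  intro n d f X Y ℓ ε r c α β x y z hXc hX hYc hY hD hf hconc hB hε hs hβ₁ hβ₀ hG
  set D := Metric.diam Y with hDdef
  have hℓ := hf.pos
  have P : IsProblem f X Y ℓ := ⟨hXc, hX, hYc, hY, ⟨y 0, hG.init_y⟩, hf, hconc⟩
  obtain ⟨hr, hrκ, hcγ, hcr, hαa, hα, hβ, hβu⟩ := hs
  have hr0 : 0 < r := by linarith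
  have hc : 0 < c := (by positivity : 0 < γ / ℓ).trans_le hcγ
  have hα0 : 0 < α := (by positivity : 0 < a / ℓ).trans_le hαa
  have hcr' : c * (r + ℓ) ≤ 1 := ((lt_div_iff₀ (by linarith)).1 hcr).le
  have hβ36 : β ≤ 1 / 36 := hβu.trans (min_le_left _ _)
  have hcγ' : 1 / c ≤ 1 / γ * ℓ := by
    rw [one_div_mul_eq_div, ← one_div_div γ]
    exact one_div_le_one_div_of_le (by positivity) hcγ
  have hαa' : 1 / α ≤ 1 / a * ℓ := by
    rw [one_div_mul_eq_div, ← one_div_div a]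
    exact one_div_le_one_div_of_le (by positivity) hαa
  have hMα : 1 / α + 3 / 2 * ℓ ≤ M * ℓ := by
    have : 0 < 1 / (2 * γ) * ℓ := by positivity
    rw [hMdef]
    linarith
  have hMc : 1 ≤ M * (c * (r - ℓ)) := by
    have h1 : 2 * γ ≤ c * (r - ℓ) := by
      rw [div_le_iff₀ hℓ] at hcγ
      nlinarith
    have h2 : 1 / (2 * γ) ≤ M := by
      have : 0 < 1 / a := by positivity
      rw [hMdef]
      linarith
    calc (1 : ℝ) = 1 / (2 * γ) * (2 * γ) := by field_simp
      _ ≤ M * (c * (r - ℓ)) := mul_le_mul h2 h1 (by positivity) hM0.le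
  have hq0 : 0 < ε ^ 2 / (ℓ ^ 2 * D ^ 2) := by positivity
  have hβ4 : β ≤ 1 / 4 * (ε ^ 2 / (ℓ ^ 2 * D ^ 2)) :=
    hβ₀.trans (mul_le_mul_of_nonneg_right (min_le_left _ _) hq0.le)
  have hβM : 9 * M ^ 2 * ℓ * β ^ 2 * D ^ 2 ≤ θ * β * ε ^ 2 / ℓ := by
    have h1 : β ≤ θ / (9 * M ^ 2) * (ε ^ 2 / (ℓ ^ 2 * D ^ 2)) :=
      hβ₀.trans (mul_le_mul_of_nonneg_right (min_le_right _ _) hq0.le)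
    calc 9 * M ^ 2 * ℓ * β ^ 2 * D ^ 2 = 9 * M ^ 2 * ℓ * β * D ^ 2 * β := by ring
      _ ≤ 9 * M ^ 2 * ℓ * β * D ^ 2 * (θ / (9 * M ^ 2) * (ε ^ 2 / (ℓ ^ 2 * D ^ 2))) := by gcongr
      _ = θ * β * ε ^ 2 / ℓ := by field_simp
  have hxX : ∀ t, x t ∈ X
    | 0 => hG.init_x
    | t + 1 => (hG.step_x t).1
  have hyY : ∀ t, y t ∈ Y
    | 0 => hG.init_y
    | t + 1 => (hG.step_y t).1
  have hxs : ∀ t, IsProj X (x t - c • (gradX f (x t) (y t) + r • (x t - z t))) (x (t + 1)) :=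
    fun t => by simpa only [P.gradient_surrogate_x] using hG.step_x t
  have hys : ∀ t, IsProj Y (y t + α • gradY f (x (t + 1)) (y t)) (y (t + 1)) :=
    fun t => by simpa only [P.gradient_surrogate_y] using hG.step_y t
  set Δ := initialGap f X Y r (x 0) (y 0) (z 0) with hΔ
  have hΔ0 : 0 ≤ Δ := sub_nonneg.2 (P.sInf_valueFn_le_potential hB (by linarith) (hxX 0) (hyY 0))
  set B := 1 / (θ * b₁) * (ℓ ^ 3 * D ^ 2 * Δ / ε ^ 4) with hBdef
  have hB0 : 0 ≤ B := by positivity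
  by_contra! hcon
  have hstep : ∀ t : ℕ, (t : ℝ) ≤ B →
      potential f X Y r (x (t + 1)) (y (t + 1)) (z (t + 1)) + θ * β * ε ^ 2 / ℓ
        ≤ potential f X Y r (x t) (y t) (z t) := by
    intro t ht
    have h1 := P.potential_step hB hr hc hcr' hα0 (hα.trans (min_le_left _ _))
      (hα.trans (min_le_right _ _)) hβ hβ36 hMα hMc (hxX t) (hyY t) (hxs t) (hys t)
    rw [← hG.step_z t] at h1
    -- Without the drop, the weighted squared steps total less than 2θβε²/ℓ: one share from the
    -- missing drop, one from the residue.
    by_contra! hlt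
    obtain ⟨s₁, s₂, s₃⟩ := stationarity_arith (δ := ‖x t - x (t + 1)‖)
      (η := ‖y (t + 1) - y t‖) (w := ‖x (t + 1) - z t‖) hℓ hr0 hc hβ (by linarith) hε hD hN0
      hNdef hγ ha hrκ hcγ' hαa' hβ4 (norm_nonneg _)
      (by linarith)
    obtain ⟨g₁, g₂⟩ := P.isGS_and_isOS_of_step hB hr0.le hc hα0 hε (hxX t) (hyY t) (hxs t)
      (hys t) s₁ s₂ s₃
    exact hcon t ht g₁ g₂
  have hsum : ∀ T : ℕ, (T : ℝ) ≤ B + 1 →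
      potential f X Y r (x T) (y T) (z T) + T * (θ * β * ε ^ 2 / ℓ)
        ≤ potential f X Y r (x 0) (y 0) (z 0) := by
    intro T
    induction T with
    | zero => simp
    | succ T ih =>
      intro hT
      push_cast at hT ⊢
      have h1 := ih (by linarith)
      have h2 := hstep T (by linarith)
      linarith
  -- The last step summed starts at index ⌊B⌋ ≤ B, where the drop still holds, while the number of
  -- steps ⌊B⌋ + 1 strictly exceeds B.
  have h1 := hsum (⌊B⌋₊ + 1) (by push_cast; linarith [Nat.floor_le hB0])
  have h2 := P.sInf_valueFn_le_potential (z := z (⌊B⌋₊ + 1)) hB (r := r) (by linarith)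
    (hxX (⌊B⌋₊ + 1)) (hyY (⌊B⌋₊ + 1))
  have h3 : B < ((⌊B⌋₊ + 1 : ℕ) : ℝ) := by
    push_cast
    exact Nat.lt_floor_add_one B
  have h4 : 0 < θ * β * ε ^ 2 / ℓ := by positivity
  have h5 : ((⌊B⌋₊ + 1 : ℕ) : ℝ) * (θ * β * ε ^ 2 / ℓ) ≤ Δ := by
    rw [hΔ, initialGap]
    linarith
  have h6 : Δ ≤ B * (θ * β * ε ^ 2 / ℓ) := by
    calc Δ = B * (θ * (b₁ * (ε ^ 2 / (ℓ ^ 2 * D ^ 2))) * ε ^ 2 / ℓ) := by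
          rw [hBdef]; field_simp
      _ ≤ B * (θ * β * ε ^ 2 / ℓ) := by gcongr
  have h7 := mul_lt_mul_of_pos_right h3 h4
  linarith
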